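/- A graphon $H=(\Omega,\mathcal A,\pi,W)$ consists of a probability space $(\Omega,\mathcal A,\pi)$ and a bounded symmetric function $W:\Omega\times\Omega\to\mathbb R$ that is measurable with respect to the completion of $(\Omega\times\Omega,\mathcal A\times\mathcal A,\pi\times\pi)$. It is Lebesguian if $(\Omega,\mathcal A,\pi)$ is a Lebesgue space, i.e. complete and isomorphic mod $0$ to the disjoint union of a closed interval (with Lebesgue measure) and a countable set of atoms. Multigraphs are finite and have no loops. For a multigraph $F$ with nodes $1,\dots,k$ let $t(F,H)=\int_{\Omega^k}\prod_{ij\in E(F)}W(x_i,x_j)\,d\pi(x_1)\cdots d\pi(x_k)$. A partially labeled multigraph is a multigraph some of whose nodes carry distinct labels from $\mathbb N=\{0,1,2,\dots\}$. For such an $F$ and $\alpha=(a_0,a_1,\dots)\in\Omega^{\mathbb N}$ let $t_\alpha(F,H)=\mathsf E\bigl(\prod_{ij\in E(F)}W(X_i,X_j)\bigr)$, where $X_i=a_\ell$ if node $i$ has label $\ell$, and where the $X_i$ for the unlabeled nodes $i$ are independent with distribution $\pi$. Let $H=(\Omega,\mathcal A,\pi,W)$ and $H'=(\Omega',\mathcal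 A',\pi',W')$ be two graphons. (1) Suppose that $H$ and $H'$ are Lebesguian and that $t(F,H)=t(F,H')$ for every multigraph $F$. Then there is a coupling of $(\Omega^{\mathbb N},\pi^{\mathbb N})$ and $(\Omega'^{\mathbb N},\pi'^{\mathbb N})$ (a probability measure on the product with these two marginals) such that, if $(\alpha,\beta)$ is drawn from it, then almost surely $t_\alpha(F,H)=t_\beta(F,H')$ for every partially labeled multigraph $F$. (2) Suppose that $0\le W\le 1$ and $0\le W'\le 1$. For $\alpha\in\Omega^{\mathbb N}$ let $\Phi_\alpha(x)=(W(x,a_0),W(x,a_1),\dots)\in[0,1]^{\mathbb N}$. If $\Phi_\alpha$ is measurable with respect to the completion of $\mathcal A$, let $\lambda_\alpha=\pi\circ\Phi_\alpha^{-1}$ be the distribution of the tags, a Borel probability measure on $[0,1]^{\mathbb N}$, and let $W_\alpha$ be the push-forward of $W$: the symmetric measurable function $[0,1]^{\mathbb N}\times[0,1]^{\mathbb N}\to[0,1]$, unique up to null sets, with $$\int_{A_1\times A_2}W_\alpha\,d\lambda_\alpha\,d\lambda_\alpha=\int_{\Phi_\alpha^{-1}(A_1)\times\Phi_\alpha^{-1}(A_2)}W\,d\pi\,d\pi$$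 for all Borel sets $A_1,A_2$. Call $\alpha$ regular for $H$ if $\Phi_\alpha$ is measurable in this sense and $W(x,y)=W_\alpha(\Phi_\alpha(x),\Phi_\alpha(y))$ for almost all $(x,y)$. Define $\lambda'_\beta$, $W'_\beta$ and regularity for $\beta\in\Omega'^{\mathbb N}$ and $H'$ in the same way. If $\alpha$ is regular for $H$, $\beta$ is regular for $H'$, and $t_\alpha(F,H)=t_\beta(F,H')$ for every partially labeled multigraph $F$, then $\lambda_\alpha=\lambda'_\beta$, and $W_\alpha=W'_\beta$ almost everywhere with respect to $\lambda_\alpha\times\lambda_\alpha$. -/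

import Mathlib

open MeasureTheory

open scoped ENNReal unitInterval

/-! ### Lebesgue spaces -/

/-- `φ` is an isomorphism mod `0` from `(α, μ)` to `(β, ν)`: it is measure preserving, and off null
sets `N ⊆ α`, `N' ⊆ β` it restricts to a bijection that is measurable and measure preserving in both
directions. -/
def IsIsoModZero {α β : Type*} [MeasurableSpace α] [MeasurableSpace β]
    (μ : Measure α) (ν : Measure β) (φ : α → β) : Prop :=
  MeasurePreserving φ μ ν ∧
    ∃ (N : Set α) (N' : Set β), MeasurableSet N ∧ μ N = 0 ∧ MeasurableSet N' ∧ ν N' = 0 ∧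
      ∃ e : ↥(Nᶜ) ≃ᵐ ↥(N'ᶜ), (∀ x, (e x : β) = φ x) ∧
        MeasurePreserving e (μ.comap Subtype.val) (ν.comap Subtype.val)

/-- The measure on the disjoint union of the closed interval `[a, b]` and a countable set `S` which
is the Lebesgue measure on the interval and puts mass `w i` on the point `i` of `S`. -/
noncomputable def intervalAtoms (a b : ℝ) (S : Set ℕ) (w : S → ℝ≥0∞) :
    Measure (↥(Set.Icc a b) ⊕ ↥S) :=
  Measure.map Sum.inl (Measure.comap Subtype.val (volume : Measure ℝ)) +
    Measure.sum fun i : S => w i • Measure.dirac (Sum.inr i)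

/-- A Lebesgue space: a complete probability space that is isomorphic mod `0` to the disjoint union
of a closed interval (with the Lebesgue measurable sets and the Lebesgue measure) and a countable
set of atoms.  The interval may have length `0`, and the set of atoms may be empty. -/
def IsLebesgueSpace {Ω : Type*} [MeasurableSpace Ω] (π : Measure Ω) : Prop :=
  IsProbabilityMeasure π ∧ π.IsComplete ∧
    ∃ (a b : ℝ) (S : Set ℕ) (w : S → ℝ≥0∞), a ≤ b ∧ (∀ i, 0 < w i) ∧
      ∃ φ : Ω → NullMeasurableSpace (↥(Set.Icc a b) ⊕ ↥S) (intervalAtoms a b S w),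
        IsIsoModZero π (intervalAtoms a b S w).completion φ

/-! ### Graphons -/

/-- A graphon on `(Ω, π)`: a bounded symmetric function `W : Ω × Ω → ℝ` which is measurable with
respect to the completion of the product space. -/
structure Graphon {Ω : Type*} [MeasurableSpace Ω] (π : Measure Ω) where
  W : Ω → Ω → ℝ
  symm : ∀ x y, W x y = W y x
  bounded : ∃ C : ℝ, ∀ x y, |W x y| ≤ C
  nullMeasurable : NullMeasurable (fun p : Ω × Ω => W p.1 p.2) (π.prod π)

/-- `0 ≤ W ≤ 1`. -/
def Graphon.UnitValued {Ω : Type*} [MeasurableSpace Ω] {π : Measure Ω} (H : Graphon π) : Prop :=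
  ∀ x y, H.W x y ∈ Set.Icc (0 : ℝ) 1

/-! ### Multigraphs and densities -/

/-- A multigraph with node set `V`: a finite multiset of edges (unordered pairs of nodes), no
loops. -/
structure Multigraph (V : Type*) where
  edges : Multiset (Sym2 V)
  loopless : ∀ e ∈ edges, ¬ e.IsDiag

/-- The value of `W` on the edge with end nodes `i`, `j`, if node `i` is mapped to `x i`. -/
def Graphon.edgeValue {Ω V : Type*} [MeasurableSpace Ω] {π : Measure Ω} (H : Graphon π)
    (x : V → Ω) : Sym2 V → ℝ :=
  Sym2.lift ⟨fun i j => H.W (x i) (x j), fun i j => H.symm (x i) (x j)⟩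

/-- `∏_{ij ∈ E(F)} W(x_i, x_j)`, the product counting edges with multiplicity. -/
def Graphon.edgeProd {Ω V : Type*} [MeasurableSpace Ω] {π : Measure Ω} (H : Graphon π)
    (F : Multigraph V) (x : V → Ω) : ℝ :=
  (F.edges.map (H.edgeValue x)).prod

/-- The density `t(F, H)`. -/
noncomputable def Graphon.density {Ω : Type*} [MeasurableSpace Ω] {π : Measure Ω} (H : Graphon π)
    {k : ℕ} (F : Multigraph (Fin k)) : ℝ :=
  ∫ x : Fin k → Ω, H.edgeProd F x ∂(Measure.pi fun _ => π)

/-- A partially labeled multigraph with `r` labeled nodes (the nodes `Sum.inl i`), carrying the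
distinct nonnegative integers `label i`, and `s` unlabeled nodes (the nodes `Sum.inr j`). -/
structure PartiallyLabeledMultigraph where
  r : ℕ
  s : ℕ
  label : Fin r ↪ ℕ
  graph : Multigraph (Fin r ⊕ Fin s)

/-- `t_α(F, H)`: the node with label `l` is mapped to `α l`, and the unlabeled nodes are mapped to
independent points with distribution `π`. -/
noncomputable def Graphon.labeledDensity {Ω : Type*} [MeasurableSpace Ω] {π : Measure Ω}
    (H : Graphon π) (α : ℕ → Ω) (F : PartiallyLabeledMultigraph) : ℝ :=
  ∫ x : Fin F.s → Ω, H.edgeProd F.graph (Sum.elim (fun i => α (F.label i)) x)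
    ∂(Measure.pi fun _ => π)

/-! ### Push-forward of a graphon -/

/-- The Radon-Nikodym derivative, with respect to the product of two copies of the image measure of
`π` under `φ`, of the measure `A ↦ ∫_{(φ × φ)⁻¹ A} W d(π × π)` (for `0 ≤ W ≤ 1`). -/
noncomputable def Graphon.pushDeriv {Ω Γ : Type*} [MeasurableSpace Ω] [MeasurableSpace Γ]
    {π : Measure Ω} (H : Graphon π) (φ : Ω → Γ) : Γ × Γ → ℝ≥0∞ :=
  (Measure.map (Prod.map φ φ)
      ((π.prod π).withDensity fun p => ENNReal.ofReal (H.W p.1 p.2))).rnDeriv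
    ((π.map φ).prod (π.map φ))

/-- The push-forward `W_φ` of a graphon with values in `[0, 1]`.  The Radon-Nikodym derivative is
symmetric and has values in `[0, 1]` almost everywhere; it is changed on a null set, by averaging and
truncating, so that this holds everywhere. It is characterized in `Graphon.pushForward_spec`. -/
noncomputable def Graphon.pushForward {Ω Γ : Type*} [MeasurableSpace Ω] [MeasurableSpace Γ]
    {π : Measure Ω} (H : Graphon π) (φ : Ω → Γ) : Graphon (π.map φ) where
  W u v := min 1 (((H.pushDeriv φ (u, v)).toReal + (H.pushDeriv φ (v, u)).toReal) / 2)
  symm u v := by rw [add_comm]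
  bounded := ⟨1, fun u v => by
    rw [abs_le]
    refine ⟨?_, min_le_left _ _⟩
    have : (0 : ℝ) ≤ min 1 (((H.pushDeriv φ (u, v)).toReal + (H.pushDeriv φ (v, u)).toReal) / 2) :=
      le_min zero_le_one (by positivity)
    linarith⟩
  nullMeasurable := by
    have h : Measurable (H.pushDeriv φ) := Measure.measurable_rnDeriv _ _
    have h' : Measurable fun p : Γ × Γ => H.pushDeriv φ (p.2, p.1) := h.comp measurable_swap
    exact (measurable_const.min
      ((h.ennreal_toReal.add h'.ennreal_toReal).div_const 2)).nullMeasurable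

/-- The defining property of the push-forward: `W_φ` has the same integral over `A₁ × A₂` as `W` has
over `φ⁻¹ A₁ × φ⁻¹ A₂`. -/
theorem Graphon.pushForward_spec {Ω Γ : Type*} [MeasurableSpace Ω] [MeasurableSpace Γ]
    {π : Measure Ω} [IsProbabilityMeasure π] (H : Graphon π) (hH : H.UnitValued) {φ : Ω → Γ}
    (hφ : AEMeasurable φ π) {A₁ A₂ : Set Γ} (h₁ : MeasurableSet A₁) (h₂ : MeasurableSet A₂) :
    ∫ p in A₁ ×ˢ A₂, (H.pushForward φ).W p.1 p.2 ∂((π.map φ).prod (π.map φ)) =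
      ∫ p in (φ ⁻¹' A₁) ×ˢ (φ ⁻¹' A₂), H.W p.1 p.2 ∂(π.prod π) := by
  have hW : AEMeasurable (fun p : Ω × Ω => H.W p.1 p.2) (π.prod π) := H.nullMeasurable.aemeasurable
  set f : Ω × Ω → ℝ≥0∞ := fun p => ENNReal.ofReal (H.W p.1 p.2) with hf
  set P : Measure (Ω × Ω) := (π.prod π).withDensity f with hP
  have hPle : P ≤ π.prod π := by
    rw [← withDensity_one (μ := π.prod π)]
    refine withDensity_mono (Filter.Eventually.of_forall fun p => ?_)
    simpa [hf] using (hH p.1 p.2).2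
  have hPfin : IsFiniteMeasure P := isFiniteMeasure_of_le _ hPle
  have hψ : AEMeasurable (Prod.map φ φ) (π.prod π) :=
    (hφ.comp_fst (ν := π)).prodMk (hφ.comp_snd (μ := π))
  have hψP : AEMeasurable (Prod.map φ φ) P := hψ.mono_measure hPle
  have hQ : (π.map φ).prod (π.map φ) = (π.prod π).map (Prod.map φ φ) := by
    rw [Measure.map_congr hφ.ae_eq_mk, Measure.map_prod_map _ _ hφ.measurable_mk hφ.measurable_mk]
    refine Measure.map_congr ?_
    filter_upwards [Measure.quasiMeasurePreserving_fst.ae_eq_comp hφ.ae_eq_mk,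
      Measure.quasiMeasurePreserving_snd.ae_eq_comp hφ.ae_eq_mk] with p h h'
    exact Prod.ext h.symm h'.symm
  have := Measure.isProbabilityMeasure_map hφ
  set Q : Measure (Γ × Γ) := (π.map φ).prod (π.map φ) with hQdef
  set M : Measure (Γ × Γ) := P.map (Prod.map φ φ) with hM
  have hMle : M ≤ Q := by
    rw [hQ]
    refine Measure.le_iff.2 fun s hs => ?_
    rw [hM, Measure.map_apply_of_aemeasurable hψP hs, Measure.map_apply_of_aemeasurable hψ hs]
    exact hPle _
  have hMfin : IsFiniteMeasure M := isFiniteMeasure_of_le _ hMle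
  have hPswap : ∀ s : Set (Ω × Ω), P (Prod.swap ⁻¹' s) = P s := by
    intro s
    rw [hP, withDensity_apply', withDensity_apply',
      ← (Measure.measurePreserving_swap (μ := π) (ν := π)).setLIntegral_comp_preimage_emb
        MeasurableEquiv.prodComm.measurableEmbedding f s]
    refine lintegral_congr fun p => ?_
    simp only [hf, Prod.fst_swap, Prod.snd_swap, H.symm p.1 p.2]
  have hMswap : M.map Prod.swap = M := by
    ext s hs
    rw [Measure.map_apply measurable_swap hs, hM,
      Measure.map_apply_of_aemeasurable hψP (measurable_swap hs),
      Measure.map_apply_of_aemeasurable hψP hs, ← hPswap]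
    rfl
  have hQswap : Q.map Prod.swap = Q := Measure.prod_swap
  have hsymm : (fun p => H.pushDeriv φ p.swap) =ᵐ[Q] H.pushDeriv φ := by
    have h := (MeasurableEquiv.prodComm (α := Γ) (β := Γ)).measurableEmbedding.rnDeriv_map M Q
    have hc : ⇑(MeasurableEquiv.prodComm (α := Γ) (β := Γ)) = Prod.swap := rfl
    rw [hc, hMswap, hQswap] at h
    exact h
  have hle : H.pushDeriv φ ≤ᵐ[Q] 1 := Measure.rnDeriv_le_one_of_le hMle
  have hae : (fun p : Γ × Γ => (H.pushForward φ).W p.1 p.2) =ᵐ[Q]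
      fun p => (H.pushDeriv φ p).toReal := by
    filter_upwards [hsymm, hle] with p h h'
    have h1 : (H.pushDeriv φ p).toReal ≤ 1 :=
      ENNReal.toReal_le_of_le_ofReal zero_le_one (by simpa using h')
    have h2 : H.pushDeriv φ (p.2, p.1) = H.pushDeriv φ p := h
    change min 1 (((H.pushDeriv φ p).toReal + (H.pushDeriv φ (p.2, p.1)).toReal) / 2) = _
    rw [h2, add_self_div_two, min_eq_right h1]
  rw [integral_congr_ae (ae_restrict_of_ae hae),
    integral_eq_lintegral_of_nonneg_ae (f := fun p : Ω × Ω => H.W p.1 p.2)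
      (Filter.Eventually.of_forall fun p => (hH p.1 p.2).1)
      hW.aestronglyMeasurable.restrict]
  refine (Measure.setIntegral_toReal_rnDeriv (Measure.absolutelyContinuous_of_le hMle) _).trans ?_
  rw [Measure.real, hM, Measure.map_apply_of_aemeasurable hψP (h₁.prod h₂), hP, withDensity_apply']
  rfl

/-! ### Anchor sequences -/

/-- The tag `Φ_α(x) = (W(x, a_0), W(x, a_1), …) ∈ [0, 1]^ℕ`. -/
def Graphon.tag {Ω : Type*} [MeasurableSpace Ω] {π : Measure Ω} (H : Graphon π)
    (hH : H.UnitValued) (α : ℕ → Ω) (x : Ω) : ℕ → I :=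
  fun i => ⟨H.W x (α i), hH x (α i)⟩

/-- The tag distribution `λ_α`, the image of `π` under `Φ_α`, on the product `σ`-algebra of
`[0, 1]^ℕ`. -/
noncomputable def Graphon.tagMeasure {Ω : Type*} [MeasurableSpace Ω] {π : Measure Ω}
    (H : Graphon π) (hH : H.UnitValued) (α : ℕ → Ω) : Measure (ℕ → I) :=
  π.map (H.tag hH α)

/-- The graphon `W_α` on `([0, 1]^ℕ, λ_α)`, the push-forward of `W` under `Φ_α`. -/
noncomputable def Graphon.tagGraphon {Ω : Type*} [MeasurableSpace Ω] {π : Measure Ω}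
    (H : Graphon π) (hH : H.UnitValued) (α : ℕ → Ω) : Graphon (H.tagMeasure hH α) :=
  H.pushForward (H.tag hH α)

/-- `α` is regular: `Φ_α` is measurable (with respect to the completion of `π`), so that `λ_α` and
`W_α` are defined, and `W(x, y) = W_α(Φ_α(x), Φ_α(y))` for almost all `(x, y)`. -/
def Graphon.IsRegular {Ω : Type*} [MeasurableSpace Ω] {π : Measure Ω}
    (H : Graphon π) (hH : H.UnitValued) (α : ℕ → Ω) : Prop :=
  NullMeasurable (H.tag hH α) π ∧
    ∀ᵐ p ∂(π.prod π), H.W p.1 p.2 = (H.tagGraphon hH α).W (H.tag hH α p.1) (H.tag hH α p.2)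

/-! ### Couplings -/

/-- `γ` is a coupling of `(X, μ)` and `(Y, ν)`: a measure on the product with marginals `μ`, `ν`. -/
def IsCoupling {X Y : Type*} [MeasurableSpace X] [MeasurableSpace Y]
    (μ : Measure X) (ν : Measure Y) (γ : Measure (X × Y)) : Prop :=
  γ.map Prod.fst = μ ∧ γ.map Prod.snd = ν

/-! Both parts rest on one principle: a probability measure on a compact Polish space is determined
by the mixed moments of a separating family of continuous functions
(`ext_of_forall_multiset_integral_prod_eq`, by Stone–Weierstrass), and here all these moments are
graph densities.

For (1), send an anchor sequence `α` to the family of all `t_α(F, H)`, a point of a countable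
product of compact intervals. A product of labeled densities is the labeled density of the graphs
glued along equal labels (`rootedDensity_glue`), and averaging over `α` removes the labels
(`integral_rootedDensity`). So the mixed moments of this random point are ordinary densities, and
the two graphons give it the same law. Two random variables with the same law can be coupled to
coincide: draw `α`, then draw `β` from its conditional distribution given the value computed from
`α` (`exists_isCoupling_ae_eq`). The conditional distribution exists on a standard Borel model,
which a Lebesgue space provides.

For (2), let `X`, `Y` be independent with law `π`. The mixed moments of the coordinates of `(Φ_α(X),
Φ_α(Y), W(X, Y))` are labeled densities of graphs with two unlabeled nodes, so this triple has the
same law for `α` and `β`. Its first marginal is `λ_α`, and by regularity its last coordinate is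
almost surely `W_α` of the first two; hence the law determines both `λ_α` and, almost everywhere,
`W_α`. -/

/-! ### Coupling random variables with equal laws -/

/-- The image of a measure under a map which is measurable with respect to the completion. -/
theorem completion_map_apply {R M : Type*} [MeasurableSpace R] [MeasurableSpace M] {ρ : Measure R}
    {f : R → M} (hf : NullMeasurable f ρ) {A : Set M} (hA : MeasurableSet A) :
    Measure.map (α := NullMeasurableSpace R ρ) f ρ.completion A = ρ (f ⁻¹' A) :=
  (Measure.map_apply (α := NullMeasurableSpace R ρ) hf hA).trans (Measure.completion_apply _ _)

open ProbabilityTheory in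
/-- Random variables with the same law can be coupled so as to be almost surely equal, if one of
them lives on the image of a standard Borel space. -/
theorem exists_isCoupling_ae_eq {M M' R X : Type*} [MeasurableSpace M] [MeasurableSpace M']
    [MeasurableSpace R] [StandardBorelSpace R] [MeasurableSpace X] [StandardBorelSpace X]
    (μ : Measure M) [IsProbabilityMeasure μ] (μ' : Measure M') [IsProbabilityMeasure μ']
    (ρ : Measure R) [IsProbabilityMeasure ρ] {ψ : R → M'} (hψ : NullMeasurable ψ ρ)
    (hρ : ∀ A, MeasurableSet A → ρ (ψ ⁻¹' A) = μ' A)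
    {T : M → X} {T' : M' → X} (hT : AEMeasurable T μ) (hT' : AEMeasurable T' μ')
    (h : μ.map T = μ'.map T') :
    ∃ γ : Measure (M × M'), IsCoupling μ μ' γ ∧ ∀ᵐ p ∂γ, T p.1 = T' p.2 := by
  have : Nonempty R := nonempty_of_isProbabilityMeasure ρ
  obtain ⟨T₀, hT₀, hTT₀⟩ := hT
  obtain ⟨T₁, hT₁, hTT₁⟩ := hT'
  have hS : AEMeasurable (T₁ ∘ ψ) ρ := (hT₁.comp_nullMeasurable hψ).aemeasurable
  -- `T₁ ∘ ψ` is measurable only for the completion of `ρ`; `S` is a measurable version of it, as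
  -- conditioning requires.
  obtain ⟨S, hS, hSS⟩ := hS
  have hlaw : μ.map T₀ = ρ.map S := by
    rw [← Measure.map_congr hTT₀, h, Measure.map_congr hTT₁]
    ext A hA
    rw [Measure.map_apply hT₁ hA, Measure.map_apply hS hA, ← hρ _ (hT₁ hA)]
    refine measure_congr ?_
    filter_upwards [hSS] with r hr
    change ((T₁ ∘ ψ) r ∈ A) = (S r ∈ A)
    rw [hr]
  -- `κ` is the law of `r` given `S r`. Under `γ₀`, `x` is drawn from `μ` and then `r` from the law
  -- conditioned on `S r = T₀ x`.
  let κ : Kernel X R := condDistrib id S ρ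
  let γ₀ : Measure (M × R) := μ ⊗ₘ κ.comap T₀ hT₀
  have hjoint : γ₀.map (Prod.map T₀ id) = ρ.map fun r => (S r, r) := by
    have h1 : (ρ.map S) ⊗ₘ κ = ρ.map fun r => (S r, r) := compProd_map_condDistrib aemeasurable_id
    rw [← h1, ← hlaw]
    ext A hA
    rw [Measure.map_apply (hT₀.prodMap measurable_id) hA,
      Measure.compProd_apply (hT₀.prodMap measurable_id hA), Measure.compProd_apply hA,
      lintegral_map (Kernel.measurable_kernel_prodMk_left hA) hT₀]
    rfl
  have hfst : γ₀.map Prod.fst = μ := Measure.fst_compProd μ _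
  have hsnd : γ₀.map Prod.snd = ρ := by
    have h2 : (γ₀.map (Prod.map T₀ id)).map Prod.snd = ρ := by
      rw [hjoint, Measure.map_map measurable_snd (hS.prodMk measurable_id')]
      exact Measure.map_id
    rwa [Measure.map_map measurable_snd (hT₀.prodMap measurable_id)] at h2
  have hae : ∀ᵐ q ∂γ₀, T₀ q.1 = S q.2 := by
    have hm : MeasurableSet {z : X × R | z.1 = S z.2} :=
      measurableSet_eq_fun measurable_fst (hS.comp measurable_snd)
    have h3 : ∀ᵐ z ∂(γ₀.map (Prod.map T₀ id)), z.1 = S z.2 := by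
      rw [hjoint, ae_map_iff (hS.prodMk measurable_id').aemeasurable hm]
      exact Filter.Eventually.of_forall fun r => rfl
    exact ae_of_ae_map (hT₀.prodMap measurable_id).aemeasurable h3
  have qsnd : Measure.QuasiMeasurePreserving Prod.snd γ₀ ρ :=
    ⟨measurable_snd, hsnd.le.absolutelyContinuous⟩
  -- The coupling on `M × M'` is the image of `γ₀` under `Ψ`. As `ψ` is only null measurable, the
  -- completion of `γ₀` is pushed forward.
  let Ψ : M × R → M × M' := fun q => (q.1, ψ q.2)
  have hΨ : NullMeasurable Ψ γ₀ :=
    Measurable.prodMk (α := NullMeasurableSpace (M × R) γ₀)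
      (fun A hA => (measurable_fst hA).nullMeasurableSet)
      (fun A hA => NullMeasurableSet.preimage (s := ψ ⁻¹' A) (hψ hA) qsnd)
  let γ : Measure (M × M') := Measure.map (α := NullMeasurableSpace (M × R) γ₀) Ψ γ₀.completion
  have hγ : ∀ A, MeasurableSet A → γ A = γ₀ (Ψ ⁻¹' A) := fun A hA => completion_map_apply hΨ hA
  have hγfst : γ.map Prod.fst = μ := by
    ext A hA
    rw [Measure.map_apply measurable_fst hA, hγ _ (measurable_fst hA), ← hfst,
      Measure.map_apply measurable_fst hA]
    rfl
  have hγsnd : γ.map Prod.snd = μ' := by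
    ext A hA
    rw [Measure.map_apply measurable_snd hA, hγ _ (measurable_snd hA), ← hρ A hA]
    exact (MeasurePreserving.mk measurable_snd hsnd).measure_preimage
      (s := ψ ⁻¹' A) (hψ hA)
  refine ⟨γ, ⟨hγfst, hγsnd⟩, ?_⟩
  have h4 : ∀ᵐ p ∂γ, T p.1 = T₀ p.1 :=
    (Measure.QuasiMeasurePreserving.mk measurable_fst hγfst.le.absolutelyContinuous).ae hTT₀
  have h5 : ∀ᵐ p ∂γ, T' p.2 = T₁ p.2 :=
    (Measure.QuasiMeasurePreserving.mk measurable_snd hγsnd.le.absolutelyContinuous).ae hTT₁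
  have h6 : ∀ᵐ p ∂γ, T₀ p.1 = T₁ p.2 := by
    have hm : MeasurableSet {p : M × M' | T₀ p.1 = T₁ p.2} :=
      measurableSet_eq_fun (hT₀.comp measurable_fst) (hT₁.comp measurable_snd)
    have h7 : ∀ᵐ q ∂γ₀, T₀ q.1 = T₁ (ψ q.2) := by
      filter_upwards [hae, qsnd.ae hSS] with q h8 h9
      rw [h8, ← h9]
      rfl
    rw [ae_iff] at h7 ⊢
    rw [← Set.compl_ofPred, hγ _ hm.compl]
    exact h7
  filter_upwards [h4, h5, h6] with p h8 h9 h10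
  rw [h8, h9, h10]

/-! ### Lebesgue spaces and their powers as images of standard Borel spaces -/

/-- An interval plus countably many atoms is Polish, so this makes it standard Borel. -/
instance Sum.instBorelSpace {α β : Type*} [TopologicalSpace α] [MeasurableSpace α] [BorelSpace α]
    [TopologicalSpace β] [MeasurableSpace β] [BorelSpace β] : BorelSpace (α ⊕ β) := by
  refine ⟨le_antisymm (fun s hs => ?_) (MeasurableSpace.generateFrom_le fun s hs => ?_)⟩
  · have h := measurableSet_sum_iff.1 hs
    rw [← Set.image_preimage_inl_union_image_preimage_inr s]
    let : MeasurableSpace (α ⊕ β) := borel _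
    have : BorelSpace (α ⊕ β) := ⟨rfl⟩
    exact (Topology.IsOpenEmbedding.inl.measurableEmbedding.measurableSet_image.2 h.1).union
      (Topology.IsOpenEmbedding.inr.measurableEmbedding.measurableSet_image.2 h.2)
  · have hs : IsOpen s := hs
    exact measurableSet_sum_iff.2 ⟨(isOpen_sum_iff.1 hs).1.measurableSet,
      (isOpen_sum_iff.1 hs).2.measurableSet⟩

/-- A Lebesgue space is the image of a standard Borel probability space. -/
theorem IsLebesgueSpace.exists_standardBorel {Ω : Type*} [MeasurableSpace Ω] {π : Measure Ω}
    (h : IsLebesgueSpace π) :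
    ∃ (R : Type) (_ : MeasurableSpace R) (_ : StandardBorelSpace R) (ρ : Measure R)
      (_ : IsProbabilityMeasure ρ) (ψ : R → Ω), NullMeasurable ψ ρ ∧
        ∀ A, MeasurableSet A → ρ (ψ ⁻¹' A) = π A := by
  obtain ⟨hπ, -, a, b, S, w, -, -, φ, hφ, N, N', hN, hN0, hN', hN'0, e, he, -⟩ := h
  have hρ : IsProbabilityMeasure (intervalAtoms a b S w) := by
    refine ⟨?_⟩
    have h1 := hφ.measure_preimage (s := Set.univ) MeasurableSet.univ.nullMeasurableSet
    rw [Set.preimage_univ, measure_univ] at h1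
    exact (Measure.completion_apply _ _).symm.trans h1.symm
  obtain ⟨x₀⟩ := nonempty_of_isProbabilityMeasure π
  classical
  -- The inverse of `φ` mod `0`; the value `x₀` on the null set `N'` is arbitrary.
  let ψ : NullMeasurableSpace (↥(Set.Icc a b) ⊕ ↥S) (intervalAtoms a b S w) → Ω :=
    fun r => if hr : r ∈ N' then x₀ else (e.symm ⟨r, hr⟩ : Ω)
  have hψ : Measurable ψ :=
    Measurable.dite (s := N') measurable_const
      (measurable_subtype_coe.comp e.symm.measurable) hN'
  have hinv : ∀ᵐ x ∂π, ψ (φ x) = x := by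
    have : ∀ᵐ x ∂π, x ∈ Nᶜ := compl_mem_ae_iff.2 hN0
    filter_upwards [this] with x hx
    have h1 : φ x ∉ N' := by rw [← he ⟨x, hx⟩]; exact (e ⟨x, hx⟩).2
    have h2 : (⟨φ x, h1⟩ : ↥(N'ᶜ)) = e ⟨x, hx⟩ := Subtype.ext (he ⟨x, hx⟩).symm
    simp only [ψ, dif_neg h1]
    rw [h2, e.symm_apply_apply]
  refine ⟨_, inferInstance, inferInstance, intervalAtoms a b S w, hρ, ψ, hψ, fun A hA => ?_⟩
  refine ((Measure.completion_apply _ _).symm.trans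
    (hφ.measure_preimage (hψ hA).nullMeasurableSet).symm).trans (measure_congr ?_)
  filter_upwards [hinv] with x hx
  change (ψ (φ x) ∈ A) = (x ∈ A)
  rw [hx]

/-- An infinite power of the image of a standard Borel probability space is such an image. -/
theorem nullMeasurable_infinitePi_map {ι R Ω : Type*} [MeasurableSpace R] [MeasurableSpace Ω]
    {ρ : Measure R} [IsProbabilityMeasure ρ] {π : Measure Ω} [IsProbabilityMeasure π] {ψ : R → Ω}
    (hψ : NullMeasurable ψ ρ) (hρ : ∀ A, MeasurableSet A → ρ (ψ ⁻¹' A) = π A) :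
    NullMeasurable (fun (r : ι → R) i => ψ (r i)) (Measure.infinitePi fun _ : ι => ρ) ∧
      ∀ A, MeasurableSet A → (Measure.infinitePi fun _ : ι => ρ)
        ((fun (r : ι → R) i => ψ (r i)) ⁻¹' A) = (Measure.infinitePi fun _ : ι => π) A := by
  set P := Measure.infinitePi fun _ : ι => ρ
  let Ψ : (ι → R) → ι → Ω := fun r i => ψ (r i)
  have hΨ : NullMeasurable Ψ P :=
    measurable_pi_iff (α := NullMeasurableSpace (ι → R) P).2 fun i A hA =>
      NullMeasurableSet.preimage (s := ψ ⁻¹' A) (hψ hA)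
        (measurePreserving_eval_infinitePi (fun _ : ι => ρ) i).quasiMeasurePreserving
  refine ⟨hΨ, fun A hA => ?_⟩
  have : Measure.map (α := NullMeasurableSpace (ι → R) P) Ψ P.completion =
      Measure.infinitePi fun _ : ι => π := by
    refine Measure.eq_infinitePi _ fun s t ht => ?_
    rw [completion_map_apply hΨ (MeasurableSet.pi s.countable_toSet fun i _ => ht i)]
    -- The sides `ψ ⁻¹' t i` are only null measurable; measurable hulls of the same measure turn the
    -- preimage into a genuine box, up to a null set.
    have h1 : (Ψ ⁻¹' Set.pi s t : Set (ι → R)) =ᵐ[P]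
        Set.pi s fun i => toMeasurable ρ (ψ ⁻¹' t i) := by
      have h2 : ∀ i ∈ s, ∀ᵐ r ∂P, (r i ∈ toMeasurable ρ (ψ ⁻¹' t i)) = (ψ (r i) ∈ t i) := by
        intro i _
        exact (measurePreserving_eval_infinitePi (fun _ : ι => ρ) i).quasiMeasurePreserving.ae
          (NullMeasurableSet.toMeasurable_ae_eq (s := ψ ⁻¹' t i) (hψ (ht i)))
      filter_upwards [(Finset.eventually_all s).2 h2] with r hr
      refine propext (forall₂_congr fun i hi => ?_)
      exact (iff_of_eq (hr i hi)).symm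
    refine (measure_congr h1).trans ?_
    rw [Measure.infinitePi_pi _ fun i _ => measurableSet_toMeasurable _ _]
    exact Finset.prod_congr rfl fun i _ => by rw [measure_toMeasurable, hρ _ (ht i)]
  rw [← this, completion_map_apply hΨ hA]

/-! ### Moments determine a measure -/

theorem Multiset.exists_map_eq_of_forall_mem_range {α β : Type*} (f : α → β) (l : Multiset β)
    (h : ∀ y ∈ l, y ∈ Set.range f) : ∃ m : Multiset α, m.map f = l := by
  induction l using Multiset.induction_on with
  | empty => exact ⟨0, rfl⟩
  | cons y l ih =>
    obtain ⟨m, rfl⟩ := ih fun z hz => h z (Multiset.mem_cons_of_mem hz)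
    obtain ⟨x, rfl⟩ := h y (Multiset.mem_cons_self y _)
    exact ⟨x ::ₘ m, Multiset.map_cons f x m⟩

/-- A finite measure on a compact Polish space is determined by the mixed moments of a separating
family of continuous functions. -/
theorem ext_of_forall_multiset_integral_prod_eq {X ι : Type*} [TopologicalSpace X] [PolishSpace X]
    [CompactSpace X] [MeasurableSpace X] [BorelSpace X] {P Q : Measure X} [IsFiniteMeasure P]
    [IsFiniteMeasure Q] (f : ι → C(X, ℝ)) (hf : ∀ x y, (∀ i, f i x = f i y) → x = y)
    (h : ∀ m : Multiset ι, ∫ x, (m.map fun i => f i x).prod ∂P =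
      ∫ x, (m.map fun i => f i x).prod ∂Q) : P = Q := by
  let g : ι → BoundedContinuousFunction X ℝ := fun i => BoundedContinuousFunction.mkOfCompact (f i)
  let A : StarSubalgebra ℝ (BoundedContinuousFunction X ℝ) :=
    { Algebra.adjoin ℝ (Set.range g) with
      star_mem' := fun {a} ha => by
        have : star a = a := by ext x; simp
        rwa [this] }
  refine ext_of_forall_mem_subalgebra_integral_eq_of_polish (𝕜 := ℝ) (A := A) ?_ ?_
  · intro x y hxy
    by_contra! hne
    refine hxy (hf x y fun i => ?_)
    exact hne _ ⟨_, ⟨g i, Algebra.subset_adjoin ⟨i, rfl⟩, rfl⟩, rfl⟩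
  · intro a ha
    -- The algebra is spanned by the monomials in the `g i`, whose integrals are the mixed moments.
    have ha' : a ∈ Submodule.span ℝ (Submonoid.closure (Set.range g) : Set _) := by
      rw [← Algebra.adjoin_eq_span]
      exact ha
    clear ha
    induction ha' using Submodule.span_induction with
    | mem b hb =>
      obtain ⟨l, hl, rfl⟩ := Submonoid.exists_multiset_of_mem_closure hb
      obtain ⟨m, rfl⟩ : ∃ m : Multiset ι, m.map g = l :=
        Multiset.exists_map_eq_of_forall_mem_range g l hl
      have heval : ∀ x, (m.map g).prod x = (m.map fun i => f i x).prod := by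
        intro x
        clear hl hb
        induction m using Multiset.induction_on with
        | empty => simp
        | cons i m ih =>
          rw [Multiset.map_cons, Multiset.prod_cons, Multiset.map_cons, Multiset.prod_cons, ← ih]
          rfl
      simp only [heval, h]
    | zero => simp
    | add b c _ _ ihb ihc =>
      simp only [BoundedContinuousFunction.coe_add, Pi.add_apply]
      rw [integral_add (b.integrable P) (c.integrable P), integral_add (b.integrable Q)
        (c.integrable Q), ihb, ihc]
    | smul r b _ ihb =>
      simp only [BoundedContinuousFunction.coe_smul]
      rw [integral_smul, integral_smul, ihb]

/-! ### Projections and concatenation for infinite product measures -/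

theorem measurePreserving_comp_infinitePi {V V' Ω : Type*} [MeasurableSpace Ω] (π : Measure Ω)
    [IsProbabilityMeasure π] {ι : V' → V} (hι : ι.Injective) :
    MeasurePreserving (fun (x : V → Ω) v => x (ι v)) (Measure.infinitePi fun _ : V => π)
      (Measure.infinitePi fun _ : V' => π) := by
  exact ⟨by fun_prop, Measure.map_infinitePi_infinitePi_of_inj hι⟩

theorem measurePreserving_eval_pair_infinitePi {V Ω : Type*} [MeasurableSpace Ω] (π : Measure Ω)
    [IsProbabilityMeasure π] {i j : V} (hij : i ≠ j) :
    MeasurePreserving (fun x : V → Ω => (x i, x j)) (Measure.infinitePi fun _ : V => π)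
      (π.prod π) := by
  exact ⟨by fun_prop, Measure.infinitePi_map_eval_prod hij⟩

theorem measurePreserving_sumElim_infinitePi {U V Ω : Type*} [MeasurableSpace Ω] (π : Measure Ω)
    [IsProbabilityMeasure π] :
    MeasurePreserving (fun p : (U → Ω) × (V → Ω) => (Sum.elim p.1 p.2 : U ⊕ V → Ω))
      ((Measure.infinitePi fun _ : U => π).prod (Measure.infinitePi fun _ : V => π))
      (Measure.infinitePi fun _ : U ⊕ V => π) := by
  have hm : Measurable (fun p : (U → Ω) × (V → Ω) => (Sum.elim p.1 p.2 : U ⊕ V → Ω)) :=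
    measurable_pi_iff.2 fun v => by cases v <;> simp only [Sum.elim_inl, Sum.elim_inr] <;> fun_prop
  refine ⟨hm, Measure.eq_infinitePi _ fun s t ht => ?_⟩
  rw [Measure.map_apply hm (MeasurableSet.pi s.countable_toSet fun i _ => ht i)]
  have : (fun p : (U → Ω) × (V → Ω) => (Sum.elim p.1 p.2 : U ⊕ V → Ω)) ⁻¹' Set.pi s t =
      (Set.pi s.toLeft fun u => t (Sum.inl u)) ×ˢ (Set.pi s.toRight fun v => t (Sum.inr v)) := by
    ext p
    simp [Set.mem_pi]
  rw [this, Measure.prod_prod, Measure.infinitePi_pi _ fun i _ => ht _,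
    Measure.infinitePi_pi _ fun i _ => ht _, Finset.prod_sum_eq_prod_toLeft_mul_prod_toRight]

/-! ### Densities of multigraphs on arbitrary node sets -/

namespace Multigraph

/-- The image of a multigraph under an injective map of nodes. -/
def map {V V' : Type*} (F : Multigraph V) (ι : V ↪ V') : Multigraph V' where
  edges := F.edges.map (Sym2.map ι)
  loopless := by
    intro e he
    obtain ⟨e, he', rfl⟩ := Multiset.mem_map.1 he
    rw [Sym2.isDiag_map ι.injective]
    exact F.loopless e he'

/-- The union of two multigraphs on the same nodes, adding multiplicities. -/
def union {V : Type*} (F G : Multigraph V) : Multigraph V where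
  edges := F.edges + G.edges
  loopless := fun e he => (Multiset.mem_add.1 he).elim (F.loopless e) (G.loopless e)

/-- A multigraph whose edges only touch the range of `ι` is the image of a multigraph. -/
theorem exists_map_eq {V V' : Type*} (ι : V' ↪ V) (F : Multigraph V)
    (h : ∀ e ∈ F.edges, ∀ v ∈ e, v ∈ Set.range ι) : ∃ F' : Multigraph V', F'.map ι = F := by
  obtain ⟨edges, loopless⟩ := F
  have h' : ∀ e ∈ edges, e ∈ Set.range (Sym2.map ι) := by
    intro e he
    induction e with
    | _ a b =>
      obtain ⟨a', rfl⟩ := h _ he a (Sym2.mem_mk_left _ _)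
      obtain ⟨b', rfl⟩ := h _ he b (Sym2.mem_mk_right _ _)
      exact ⟨s(a', b'), rfl⟩
  obtain ⟨edges', rfl⟩ : ∃ m : Multiset (Sym2 V'), m.map (Sym2.map ι) = edges :=
    Multiset.exists_map_eq_of_forall_mem_range _ _ h'
  refine ⟨⟨edges', fun e he => ?_⟩, rfl⟩
  rw [← Sym2.isDiag_map ι.injective]
  exact loopless _ (Multiset.mem_map_of_mem _ he)

/-- The edges of a multigraph touch only finitely many nodes. -/
theorem exists_finset_support {V : Type*} (F : Multigraph V) :
    ∃ t : Finset V, ∀ e ∈ F.edges, ∀ v ∈ e, v ∈ t := by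
  classical
  exact ⟨F.edges.toFinset.biUnion Sym2.toFinset, fun e he v hv =>
    Finset.mem_biUnion.2 ⟨e, Multiset.mem_toFinset.2 he, Sym2.mem_toFinset.2 hv⟩⟩

end Multigraph

namespace Graphon

variable {Ω : Type*} [MeasurableSpace Ω] {π : Measure Ω} (H : Graphon π)

theorem edgeProd_map {V V' : Type*} (F : Multigraph V) (ι : V ↪ V') (x : V' → Ω) :
    H.edgeProd (F.map ι) x = H.edgeProd F fun v => x (ι v) := by
  simp only [edgeProd, Multigraph.map, Multiset.map_map]
  congr 2
  funext e
  induction e with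
  | _ a b => rfl

theorem edgeProd_union {V : Type*} (F G : Multigraph V) (x : V → Ω) :
    H.edgeProd (F.union G) x = H.edgeProd F x * H.edgeProd G x := by
  simp [edgeProd, Multigraph.union]

theorem abs_edgeProd_le {V : Type*} {C : ℝ} (hC : 0 ≤ C) (hW : ∀ x y, |H.W x y| ≤ C)
    (F : Multigraph V) (x : V → Ω) : |H.edgeProd F x| ≤ C ^ Multiset.card F.edges := by
  simp only [edgeProd]
  generalize F.edges = edges
  induction edges using Multiset.induction_on with
  | empty => simp
  | cons e m ih =>
    rw [Multiset.map_cons, Multiset.prod_cons, Multiset.card_cons, pow_succ', abs_mul]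
    refine mul_le_mul ?_ ih (abs_nonneg _) hC
    induction e with
    | _ a b => exact hW _ _

theorem aestronglyMeasurable_edgeProd [IsProbabilityMeasure π] {V : Type*} (F : Multigraph V) :
    AEStronglyMeasurable (H.edgeProd F) (Measure.infinitePi fun _ : V => π) := by
  obtain ⟨edges, hF⟩ := F
  change AEStronglyMeasurable (fun x => (edges.map (H.edgeValue x)).prod) _
  induction edges using Multiset.induction_on with
  | empty => simpa using aestronglyMeasurable_const
  | cons e m ih =>
    simp only [Multiset.map_cons, Multiset.prod_cons]
    refine AEStronglyMeasurable.mul ?_ (ih fun e he => hF e (Multiset.mem_cons_of_mem he))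
    have he := hF e (Multiset.mem_cons_self e m)
    induction e with
    | _ a b =>
      -- Absence of loops matters here: the two end nodes are distinct, so their images have joint
      -- law `π.prod π`, for which `W` is measurable.
      exact H.nullMeasurable.aemeasurable.aestronglyMeasurable.comp_measurePreserving
        (measurePreserving_eval_pair_infinitePi π he)

theorem integrable_edgeProd [IsProbabilityMeasure π] {V : Type*} (F : Multigraph V) :
    Integrable (H.edgeProd F) (Measure.infinitePi fun _ : V => π) := by
  obtain ⟨C, hC⟩ := H.bounded
  exact .of_bound (H.aestronglyMeasurable_edgeProd F) (max C 0 ^ Multiset.card F.edges)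
    (Filter.Eventually.of_forall fun x => H.abs_edgeProd_le (le_max_right _ _)
      (fun x y => (hC x y).trans (le_max_left _ _)) F x)

/-- The density of a multigraph on the image of an injective map of nodes. -/
theorem integral_edgeProd_map [IsProbabilityMeasure π] {k : ℕ} {V : Type*} (F : Multigraph (Fin k))
    (ι : Fin k ↪ V) :
    ∫ x, H.edgeProd (F.map ι) x ∂(Measure.infinitePi fun _ : V => π) = H.density F := by
  have h := measurePreserving_comp_infinitePi π ι.injective
  rw [density, ← Measure.infinitePi_eq_pi, ← h.map_eq, integral_map h.measurable.aemeasurable]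
  · simp only [edgeProd_map]
  · rw [h.map_eq]
    exact H.aestronglyMeasurable_edgeProd F

/-- Graphons with the same densities have the same densities for graphs on arbitrary node sets. -/
theorem integral_edgeProd_eq {Ω' : Type*} [MeasurableSpace Ω'] {π' : Measure Ω'}
    [IsProbabilityMeasure π] [IsProbabilityMeasure π'] {H : Graphon π} {H' : Graphon π'}
    (h : ∀ (k : ℕ) (F : Multigraph (Fin k)), H.density F = H'.density F) {V : Type*}
    (F : Multigraph V) :
    ∫ x, H.edgeProd F x ∂(Measure.infinitePi fun _ : V => π) =
      ∫ x, H'.edgeProd F x ∂(Measure.infinitePi fun _ : V => π') := by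
  obtain ⟨t, ht⟩ := F.exists_finset_support
  let ι : Fin t.card ↪ V := t.equivFin.symm.toEmbedding.trans (.subtype _)
  obtain ⟨F, rfl⟩ := Multigraph.exists_map_eq ι F fun e he v hv =>
    ⟨t.equivFin ⟨v, ht e he v hv⟩, by simp [ι]⟩
  rw [integral_edgeProd_map, integral_edgeProd_map, h]

end Graphon

/-! ### Rooted densities and the coupling of anchor sequences -/

/-- Countability makes the product of intervals indexed by these graphs Polish, and lets
measurability be checked coordinatewise. -/
instance PartiallyLabeledMultigraph.instCountable : Countable PartiallyLabeledMultigraph := by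
  have h1 : ∀ r s : ℕ, Countable (Multigraph (Fin r ⊕ Fin s)) := fun r s => by
    have : Countable (Sym2 (Fin r ⊕ Fin s)) := Quot.mk_surjective.countable
    refine Function.Injective.countable (f := Multigraph.edges) fun F G h => ?_
    cases F; cases G; cases h; rfl
  have h2 : ∀ r : ℕ, Countable (Fin r ↪ ℕ) := fun r => DFunLike.coe_injective.countable
  refine Function.Injective.countable
    (f := fun F => (⟨F.r, F.s, F.label, F.graph⟩ :
      Σ (r : ℕ) (s : ℕ), (Fin r ↪ ℕ) × Multigraph (Fin r ⊕ Fin s))) fun F G h => ?_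
  cases F; cases G; cases h; rfl

namespace PartiallyLabeledMultigraph

/-- A partially labeled multigraph as a multigraph whose labeled nodes are natural numbers. -/
def toMultigraph (F : PartiallyLabeledMultigraph) : Multigraph (ℕ ⊕ Fin F.s) :=
  F.graph.map (F.label.sumMap (.refl _))

end PartiallyLabeledMultigraph

namespace Multigraph

/-- The union of two multigraphs which share exactly the nodes in `U`. -/
def glue {U V V' : Type*} (F : Multigraph (U ⊕ V)) (G : Multigraph (U ⊕ V')) :
    Multigraph (U ⊕ (V ⊕ V')) :=
  (F.map ((Function.Embedding.refl U).sumMap .inl)).union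
    (G.map ((Function.Embedding.refl U).sumMap .inr))

end Multigraph

namespace Graphon

variable {Ω : Type*} [MeasurableSpace Ω] {π : Measure Ω} [IsProbabilityMeasure π] (H : Graphon π)

/-- The density of a multigraph whose nodes in `U` are mapped to the points `α u`. -/
noncomputable def rootedDensity {U V : Type*} (α : U → Ω) (G : Multigraph (U ⊕ V)) : ℝ :=
  ∫ x, H.edgeProd G (Sum.elim α x) ∂(Measure.infinitePi fun _ : V => π)

theorem labeledDensity_eq_rootedDensity (α : ℕ → Ω) (F : PartiallyLabeledMultigraph) :
    H.labeledDensity α F = H.rootedDensity α F.toMultigraph := by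
  rw [labeledDensity, rootedDensity, ← Measure.infinitePi_eq_pi]
  simp only [PartiallyLabeledMultigraph.toMultigraph, edgeProd_map]
  congr 1
  funext x
  congr 1
  funext v
  cases v <;> rfl

/-- Once the roots are fixed, the two blocks of unlabeled nodes are independent, so the integral
factors. -/
theorem rootedDensity_glue {U V V' : Type*} (α : U → Ω) (F : Multigraph (U ⊕ V))
    (G : Multigraph (U ⊕ V')) :
    H.rootedDensity α (F.glue G) = H.rootedDensity α F * H.rootedDensity α G := by
  have h : MeasurePreserving (MeasurableEquiv.sumPiEquivProdPi fun _ : V ⊕ V' => Ω).symm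
      ((Measure.infinitePi fun _ : V => π).prod (Measure.infinitePi fun _ : V' => π))
      (Measure.infinitePi fun _ : V ⊕ V' => π) := by
    convert measurePreserving_sumElim_infinitePi (U := V) (V := V') π using 1
    funext p v
    cases v <;> rfl
  rw [rootedDensity, rootedDensity, rootedDensity, ← integral_prod_mul, ← h.integral_comp']
  congr 1
  funext p
  rw [Multigraph.glue, edgeProd_union, edgeProd_map, edgeProd_map]
  congr 2 <;> funext v <;> cases v <;> rfl

theorem abs_rootedDensity_le {C : ℝ} (hC : 0 ≤ C) (hW : ∀ x y, |H.W x y| ≤ C) {U V : Type*}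
    (α : U → Ω) (G : Multigraph (U ⊕ V)) :
    |H.rootedDensity α G| ≤ C ^ Multiset.card G.edges := by
  have := norm_integral_le_of_norm_le_const (μ := Measure.infinitePi fun _ : V => π)
    (f := fun x => H.edgeProd G (Sum.elim α x))
    (Filter.Eventually.of_forall fun x => H.abs_edgeProd_le hC hW G _)
  simpa [rootedDensity] using this

theorem integrable_edgeProd_sumElim {U V : Type*} (G : Multigraph (U ⊕ V)) :
    Integrable (fun p : (U → Ω) × (V → Ω) => H.edgeProd G (Sum.elim p.1 p.2))
      ((Measure.infinitePi fun _ : U => π).prod (Measure.infinitePi fun _ : V => π)) :=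
  (measurePreserving_sumElim_infinitePi π).integrable_comp_of_integrable (H.integrable_edgeProd G)

theorem aestronglyMeasurable_rootedDensity {U V : Type*} (G : Multigraph (U ⊕ V)) :
    AEStronglyMeasurable (fun α => H.rootedDensity α G) (Measure.infinitePi fun _ : U => π) :=
  (H.integrable_edgeProd_sumElim G).aestronglyMeasurable.integral_prod_right'

/-- Fubini: choosing the roots at random makes them unlabeled nodes. -/
theorem integral_rootedDensity {U V : Type*} (G : Multigraph (U ⊕ V)) :
    ∫ α, H.rootedDensity α G ∂(Measure.infinitePi fun _ : U => π) =
      ∫ x, H.edgeProd G x ∂(Measure.infinitePi fun _ : U ⊕ V => π) := by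
  have h := measurePreserving_sumElim_infinitePi (U := U) (V := V) π
  rw [← h.map_eq, integral_map h.measurable.aemeasurable, integral_prod _
    (H.integrable_edgeProd_sumElim G)]
  · rfl
  · rw [h.map_eq]
    exact H.aestronglyMeasurable_edgeProd G

variable {Ω' : Type*} [MeasurableSpace Ω'] {π' : Measure Ω'} [IsProbabilityMeasure π']
  (H' : Graphon π')

/-- A product of rooted densities is a rooted density. -/
theorem exists_rootedDensity_eq_prod {ι U : Type*} {V : ι → Type} (F : ∀ i, Multigraph (U ⊕ V i))
    (m : Multiset ι) :
    ∃ (V' : Type) (G : Multigraph (U ⊕ V')),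
      (∀ α, (m.map fun i => H.rootedDensity α (F i)).prod = H.rootedDensity α G) ∧
      ∀ β, (m.map fun i => H'.rootedDensity β (F i)).prod = H'.rootedDensity β G := by
  induction m using Multiset.induction_on with
  | empty =>
    exact ⟨Empty, ⟨0, by simp⟩, fun α => by simp [rootedDensity, edgeProd],
      fun β => by simp [rootedDensity, edgeProd]⟩
  | cons i m ih =>
    obtain ⟨V', G, h, h'⟩ := ih
    exact ⟨V i ⊕ V', (F i).glue G,
      fun α => by rw [Multiset.map_cons, Multiset.prod_cons, h, rootedDensity_glue],
      fun β => by rw [Multiset.map_cons, Multiset.prod_cons, h', rootedDensity_glue]⟩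

variable {H H'}

/-- Anchor sequences of graphons with the same densities can be coupled so that the labeled
densities agree. -/
theorem exists_isCoupling_labeledDensity_eq (hπ' : IsLebesgueSpace π')
    (h : ∀ (k : ℕ) (F : Multigraph (Fin k)), H.density F = H'.density F) :
    ∃ γ : Measure ((ℕ → Ω) × (ℕ → Ω')),
      IsCoupling (Measure.infinitePi fun _ : ℕ => π) (Measure.infinitePi fun _ : ℕ => π') γ ∧
      ∀ᵐ p ∂γ, ∀ F : PartiallyLabeledMultigraph,
        H.labeledDensity p.1 F = H'.labeledDensity p.2 F := by
  obtain ⟨C, hC, hW, hW'⟩ : ∃ C : ℝ, 0 ≤ C ∧ (∀ x y, |H.W x y| ≤ C) ∧ ∀ x y, |H'.W x y| ≤ C := by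
    obtain ⟨C₁, h₁⟩ := H.bounded
    obtain ⟨C₂, h₂⟩ := H'.bounded
    exact ⟨max 0 (max C₁ C₂), le_max_left _ _,
      fun x y => (h₁ x y).trans ((le_max_left _ _).trans (le_max_right _ _)),
      fun x y => (h₂ x y).trans ((le_max_right _ _).trans (le_max_right _ _))⟩
  -- These bounds, common to both graphons, place the values of `T` and `T'` in one compact space
  -- `X`.
  let B : PartiallyLabeledMultigraph → ℝ := fun F => C ^ Multiset.card F.toMultigraph.edges
  let X := ∀ F, Set.Icc (-B F) (B F)
  let T : (ℕ → Ω) → X := fun α F => ⟨H.rootedDensity α F.toMultigraph,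
    abs_le.1 (H.abs_rootedDensity_le hC hW α _)⟩
  let T' : (ℕ → Ω') → X := fun β F => ⟨H'.rootedDensity β F.toMultigraph,
    abs_le.1 (H'.abs_rootedDensity_le hC hW' β _)⟩
  have hT : AEMeasurable T (Measure.infinitePi fun _ : ℕ => π) := aemeasurable_pi_iff.2 fun F =>
    (H.aestronglyMeasurable_rootedDensity _).aemeasurable.subtype_mk
  have hT' : AEMeasurable T' (Measure.infinitePi fun _ : ℕ => π') := aemeasurable_pi_iff.2 fun F =>
    (H'.aestronglyMeasurable_rootedDensity _).aemeasurable.subtype_mk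
  let f : PartiallyLabeledMultigraph → C(X, ℝ) := fun F =>
    ⟨fun x => x F, continuous_subtype_val.comp (continuous_apply F)⟩
  have hf : ∀ m : Multiset PartiallyLabeledMultigraph,
      Continuous fun x : X => (m.map fun F => f F x).prod := fun m =>
    continuous_multiset_prod m fun F _ => (f F).continuous
  have hlaw : (Measure.infinitePi fun _ : ℕ => π).map T =
      (Measure.infinitePi fun _ : ℕ => π').map T' := by
    refine ext_of_forall_multiset_integral_prod_eq f
      (fun x y hxy => funext fun F => Subtype.ext (hxy F)) fun m => ?_
    rw [integral_map hT (hf m).aestronglyMeasurable, integral_map hT' (hf m).aestronglyMeasurable]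
    -- The same glued graph `G` expresses the moment for both graphons.
    obtain ⟨V, G, hG, hG'⟩ := H.exists_rootedDensity_eq_prod H'
      (fun F : PartiallyLabeledMultigraph => F.toMultigraph) m
    calc _ = ∫ α, H.rootedDensity α G ∂(Measure.infinitePi fun _ : ℕ => π) := by
          simp only [← hG]; rfl
      _ = ∫ β, H'.rootedDensity β G ∂(Measure.infinitePi fun _ : ℕ => π') := by
          rw [integral_rootedDensity, integral_rootedDensity, integral_edgeProd_eq h]
      _ = _ := by simp only [← hG']; rfl
  obtain ⟨R, _, _, ρ, _, ψ, hψ, hρ⟩ := hπ'.exists_standardBorel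
  obtain ⟨hΨ, hP⟩ := nullMeasurable_infinitePi_map (ι := ℕ) hψ hρ
  obtain ⟨γ, hγ, hTT⟩ := exists_isCoupling_ae_eq _ _ _ hΨ hP hT hT' hlaw
  refine ⟨γ, hγ, hTT.mono fun p hp F => ?_⟩
  rw [labeledDensity_eq_rootedDensity, labeledDensity_eq_rootedDensity]
  exact congrArg Subtype.val (congrFun hp F)

end Graphon

/-! ### Regular anchor sequences: the joint law of two tags and the edge value -/

/-- The graph with two unlabeled nodes whose edges are listed by `m`: `none` stands for the edge
between the unlabeled nodes, and `some (Sum.inl i)`, `some (Sum.inr i)` for the edges from the first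
and from the second unlabeled node to the node labeled `i`. -/
def Multigraph.doubleStar (m : Multiset (Option (ℕ ⊕ ℕ))) : Multigraph (ℕ ⊕ Fin 2) where
  edges := m.map fun c => c.elim s(Sum.inr 0, Sum.inr 1)
    (Sum.elim (fun i => s(Sum.inr 0, Sum.inl i)) fun i => s(Sum.inr 1, Sum.inl i))
  loopless := by
    intro e he
    obtain ⟨c, -, rfl⟩ := Multiset.mem_map.1 he
    rcases c with _ | i | i <;> simp

namespace Graphon

variable {Ω : Type*} [MeasurableSpace Ω] {π : Measure Ω} {H : Graphon π}
  {Ω' : Type*} [MeasurableSpace Ω'] {π' : Measure Ω'} {H' : Graphon π'}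

theorem measurable_pushForward {Γ : Type*} [MeasurableSpace Γ] (H : Graphon π) (φ : Ω → Γ) :
    Measurable fun p : Γ × Γ => (H.pushForward φ).W p.1 p.2 := by
  have h : Measurable (H.pushDeriv φ) := Measure.measurable_rnDeriv _ _
  have h' : Measurable fun p : Γ × Γ => H.pushDeriv φ (p.2, p.1) := h.comp measurable_swap
  exact measurable_const.min ((h.ennreal_toReal.add h'.ennreal_toReal).div_const 2)

/-- The tags of two points, together with the value of the graphon at this pair. -/
def tagPair (hH : H.UnitValued) (α : ℕ → Ω) (p : Ω × Ω) : (ℕ → I) × (ℕ → I) × I :=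
  (H.tag hH α p.1, H.tag hH α p.2, ⟨H.W p.1 p.2, hH p.1 p.2⟩)

theorem aemeasurable_tagPair {hH : H.UnitValued} {α : ℕ → Ω} (hα : AEMeasurable (H.tag hH α) π) :
    AEMeasurable (tagPair hH α) (π.prod π) :=
  hα.comp_fst.prodMk (hα.comp_snd.prodMk H.nullMeasurable.aemeasurable.subtype_mk)

/-- Regularity becomes a property of the law of `tagPair`: it is concentrated on the graph of `W_α`.
Only in this form can it be compared across different spaces. -/
theorem IsRegular.ae_map_tagPair {hH : H.UnitValued} {α : ℕ → Ω} (h : H.IsRegular hH α) :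
    ∀ᵐ q ∂((π.prod π).map (tagPair hH α)), (q.2.2 : ℝ) = (H.tagGraphon hH α).W q.1 q.2.1 := by
  have hm : Measurable fun q : (ℕ → I) × (ℕ → I) × I => (H.tagGraphon hH α).W q.1 q.2.1 :=
    (H.measurable_pushForward (H.tag hH α)).comp
      (measurable_fst.prodMk (measurable_fst.comp measurable_snd))
  have hset : MeasurableSet {q : (ℕ → I) × (ℕ → I) × I |
      (q.2.2 : ℝ) = (H.tagGraphon hH α).W q.1 q.2.1} :=
    measurableSet_eq_fun (measurable_subtype_coe.comp (measurable_snd.comp measurable_snd)) hm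
  rw [ae_map_iff (aemeasurable_tagPair h.1.aemeasurable) hset]
  exact h.2

variable [IsProbabilityMeasure π] [IsProbabilityMeasure π']

/-- The edges of `G` touch only labels below some `n`. Keeping all the labels below `n` adds at most
isolated nodes, which do not affect the edge product. -/
theorem rootedDensity_eq_of_labeledDensity_eq {α : ℕ → Ω} {β : ℕ → Ω'}
    (h : ∀ F, H.labeledDensity α F = H'.labeledDensity β F) {s : ℕ}
    (G : Multigraph (ℕ ⊕ Fin s)) : H.rootedDensity α G = H'.rootedDensity β G := by
  obtain ⟨t, ht⟩ := G.exists_finset_support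
  obtain ⟨n, hn⟩ := t.toLeft.exists_nat_subset_range
  let ι : Fin n ⊕ Fin s ↪ ℕ ⊕ Fin s := Fin.valEmbedding.sumMap (.refl _)
  obtain ⟨G, rfl⟩ := Multigraph.exists_map_eq ι G fun e he v hv => by
    have hv := ht e he v hv
    rcases v with i | j
    · exact ⟨Sum.inl ⟨i, Finset.mem_range.1 (hn (Finset.mem_toLeft.2 hv))⟩, rfl⟩
    · exact ⟨Sum.inr j, rfl⟩
  have := h ⟨n, s, Fin.valEmbedding, G⟩
  rwa [labeledDensity_eq_rootedDensity, labeledDensity_eq_rootedDensity] at this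

/-- The coordinates of `tagPair`. -/
def tagPairCoord : Option (ℕ ⊕ ℕ) → C((ℕ → I) × (ℕ → I) × I, ℝ)
  | none => ⟨fun q => q.2.2, by fun_prop⟩
  | some (Sum.inl i) => ⟨fun q => q.1 i, by fun_prop⟩
  | some (Sum.inr i) => ⟨fun q => q.2.1 i, by fun_prop⟩

/-- Each coordinate is the value of `W` on one edge of the double star, so a monomial in the
coordinates is an edge product at two independent points. -/
theorem integral_prod_tagPairCoord {hH : H.UnitValued} {α : ℕ → Ω}
    (hα : AEMeasurable (H.tag hH α) π) (m : Multiset (Option (ℕ ⊕ ℕ))) :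
    ∫ q, (m.map fun c => tagPairCoord c q).prod ∂((π.prod π).map (tagPair hH α)) =
      H.rootedDensity α (.doubleStar m) := by
  have hm : Continuous fun q => (m.map fun c => tagPairCoord c q).prod :=
    continuous_multiset_prod m fun c _ => (tagPairCoord c).continuous
  have h := measurePreserving_eval_pair_infinitePi π (zero_ne_one (α := Fin 2))
  have hmeas := hm.comp_aestronglyMeasurable (aemeasurable_tagPair hα).aestronglyMeasurable
  rw [integral_map (aemeasurable_tagPair hα) hm.aestronglyMeasurable]
  rw [← h.map_eq] at hmeas ⊢
  rw [integral_map h.measurable.aemeasurable hmeas, rootedDensity]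
  congr 1
  funext x
  simp only [edgeProd, Multigraph.doubleStar, Multiset.map_map]
  congr 2
  funext c
  rcases c with _ | i | i <;> rfl

theorem map_tagPair_eq {hH : H.UnitValued} {hH' : H'.UnitValued} {α : ℕ → Ω} {β : ℕ → Ω'}
    (hα : AEMeasurable (H.tag hH α) π) (hβ : AEMeasurable (H'.tag hH' β) π')
    (h : ∀ F, H.labeledDensity α F = H'.labeledDensity β F) :
    (π.prod π).map (tagPair hH α) = (π'.prod π').map (tagPair hH' β) := by
  refine ext_of_forall_multiset_integral_prod_eq tagPairCoord (fun q r hqr => ?_) fun m => ?_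
  · exact Prod.ext (funext fun i => Subtype.ext (hqr (some (Sum.inl i))))
      (Prod.ext (funext fun i => Subtype.ext (hqr (some (Sum.inr i)))) (Subtype.ext (hqr none)))
  · rw [integral_prod_tagPairCoord hα, integral_prod_tagPairCoord hβ]
    exact rootedDensity_eq_of_labeledDensity_eq h _

theorem map_fst_map_tagPair {hH : H.UnitValued} {α : ℕ → Ω} (hα : AEMeasurable (H.tag hH α) π) :
    ((π.prod π).map (tagPair hH α)).map Prod.fst = H.tagMeasure hH α := by
  rw [AEMeasurable.map_map_of_aemeasurable measurable_fst.aemeasurable (aemeasurable_tagPair hα)]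
  have hfst : (π.prod π).map Prod.fst = π := by rw [Measure.map_fst_prod, measure_univ, one_smul]
  have : (π.prod π).map (H.tag hH α ∘ Prod.fst) = ((π.prod π).map Prod.fst).map (H.tag hH α) :=
    (AEMeasurable.map_map_of_aemeasurable (by rwa [hfst]) measurable_fst.aemeasurable).symm
  rw [hfst] at this
  exact this

theorem map_tags_map_tagPair {hH : H.UnitValued} {α : ℕ → Ω}
    (hα : AEMeasurable (H.tag hH α) π) :
    ((π.prod π).map (tagPair hH α)).map (fun q => (q.1, q.2.1)) =
      (H.tagMeasure hH α).prod (H.tagMeasure hH α) := by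
  rw [AEMeasurable.map_map_of_aemeasurable (by fun_prop) (aemeasurable_tagPair hα), tagMeasure,
    Measure.map_congr hα.ae_eq_mk, Measure.map_prod_map _ _ hα.measurable_mk hα.measurable_mk]
  refine Measure.map_congr ?_
  filter_upwards [Measure.quasiMeasurePreserving_fst.ae_eq_comp hα.ae_eq_mk,
    Measure.quasiMeasurePreserving_snd.ae_eq_comp hα.ae_eq_mk] with p h h'
  exact Prod.ext h h'

/-- Regular anchor sequences with the same labeled densities have the same tag distribution and the
same push-forward graphon. -/
theorem IsRegular.tagMeasure_eq_and_ae_eq {hH : H.UnitValued} {hH' : H'.UnitValued} {α : ℕ → Ω}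
    {β : ℕ → Ω'} (hα : H.IsRegular hH α) (hβ : H'.IsRegular hH' β)
    (h : ∀ F, H.labeledDensity α F = H'.labeledDensity β F) :
    H.tagMeasure hH α = H'.tagMeasure hH' β ∧
      ∀ᵐ p ∂((H.tagMeasure hH α).prod (H.tagMeasure hH α)),
        (H.tagGraphon hH α).W p.1 p.2 = (H'.tagGraphon hH' β).W p.1 p.2 := by
  have hα' := hα.1.aemeasurable
  have hβ' := hβ.1.aemeasurable
  have hlaw := map_tagPair_eq hα' hβ' h
  refine ⟨by rw [← map_fst_map_tagPair hα', ← map_fst_map_tagPair hβ', hlaw], ?_⟩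
  have hset : MeasurableSet {p : (ℕ → I) × (ℕ → I) |
      (H.tagGraphon hH α).W p.1 p.2 = (H'.tagGraphon hH' β).W p.1 p.2} :=
    measurableSet_eq_fun (H.measurable_pushForward (H.tag hH α))
      (H'.measurable_pushForward (H'.tag hH' β))
  -- The claim is lifted to the common law of the triples, where both push-forwards equal the last
  -- coordinate.
  rw [← map_tags_map_tagPair hα', ae_map_iff (by fun_prop) hset]
  have h₁ := hα.ae_map_tagPair
  have h₂ := hβ.ae_map_tagPair
  rw [← hlaw] at h₂
  filter_upwards [h₁, h₂] with q h₃ h₄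
  exact h₃.symm.trans h₄

end Graphon

theorem lemma5p3 {Ω Ω' : Type*} [MeasurableSpace Ω] [MeasurableSpace Ω']
    (π : Measure Ω) (π' : Measure Ω') [IsProbabilityMeasure π] [IsProbabilityMeasure π']
    (H : Graphon π) (H' : Graphon π') :
    -- coupling of anchor sequences
    (IsLebesgueSpace π → IsLebesgueSpace π' →
      (∀ (k : ℕ) (F : Multigraph (Fin k)), H.density F = H'.density F) →
      ∃ γ : Measure ((ℕ → Ω) × (ℕ → Ω')),
        IsCoupling (Measure.infinitePi fun _ : ℕ => π) (Measure.infinitePi fun _ : ℕ => π') γ ∧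
        ∀ᵐ p ∂γ, ∀ F : PartiallyLabeledMultigraph,
          H.labeledDensity p.1 F = H'.labeledDensity p.2 F) ∧
    -- regular anchor sequences with equal labeled densities
    (∀ (hH : H.UnitValued) (hH' : H'.UnitValued) (α : ℕ → Ω) (β : ℕ → Ω'),
      H.IsRegular hH α → H'.IsRegular hH' β →
      (∀ F : PartiallyLabeledMultigraph, H.labeledDensity α F = H'.labeledDensity β F) →
      H.tagMeasure hH α = H'.tagMeasure hH' β ∧
      ∀ᵐ p ∂((H.tagMeasure hH α).prod (H.tagMeasure hH α)),
        (H.tagGraphon hH α).W p.1 p.2 = (H'.tagGraphon hH' β).W p.1 p.2) := by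
  exact ⟨fun _ hπ' h => Graphon.exists_isCoupling_labeledDensity_eq hπ' h,
    fun _ _ _ _ hα hβ h => hα.tagMeasure_eq_and_ae_eq hβ h⟩
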